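/- Let $\Gamma$ be a finite simplicial complex whose vertex set $V$ has $n$ elements, and let $G=\Gamma^{(1)}$ be its 1-skeleton, regarded as a simple graph on $V$. A \emph{flat} of $G$ is a set $F$ of edges of $G$ such that each connected component of the graph $(V,F)$ is an induced subgraph of $G$; write $\mathcal F(G)$ for the set of flats, $c(F)$ for the number of connected components of $(V,F)$, $G/F$ for the graph obtained from $G$ by contracting the edges in $F$, and $a(H)$ for the number of acyclic orientations of a graph $H$. Then $$(-1)^n=\sum_{F\in\mathcal F(\Gamma^{(1)})}(-1)^{c(F)}\,a(\Gamma^{(1)}/F).$$ Moreover, let $\mathbb K$ be a field and let $\mathcal A$ be the Hopf algebra of simplicial complexes over $\mathbb K$: the $\mathbb K$-vector space with basis the isomorphism classes $[\Gamma]$ of finite simplicial complexes, with product $[\Gamma]\cdot[\Theta]=[\Gamma\uplus\Theta]$ (disjoint union), unit $[\varnothing]$ (the complex without vertices), coproduct $\Delta([\Gamma])=\sum_{T\subseteq V(\Gamma)}[\Gamma_T]\otimes[\Gamma_{V(\Gamma)- T}]$ (where $\Gamma_T$ is the complex induced on $T$), counit $\epsilon([\Gamma])=\delta_{[\Gamma],[\varnothing]}$,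 and antipode $S$. Then the coefficients of $S([\Gamma])$ in the basis of isomorphism classes sum to $(-1)^n$ in $\mathbb K$. -/

import Mathlib

open scoped TensorProduct

/-! ### Graphs: flats, contraction, acyclic orientations -/

namespace SimpleGraph

/-- The spanning subgraph of `G` with edge set `F`, for a set `F` of edges of `G`,
is `SimpleGraph.fromEdgeSet F`. A set `F` of edges of `G` is a *flat* of `G` if every connected
component of that spanning subgraph is an induced subgraph of `G`. -/
def IsFlat {V : Type*} (G : SimpleGraph V) (F : Set (Sym2 V)) : Prop :=
  F ⊆ G.edgeSet ∧
    ∀ c : (fromEdgeSet F).ConnectedComponent,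
      (fromEdgeSet F).induce c.supp = G.induce c.supp

/-- The finite set of all flats of a graph on a finite vertex set. -/
noncomputable def flats {V : Type*} [Finite V] (G : SimpleGraph V) : Finset (Set (Sym2 V)) :=
  (Set.toFinite {F : Set (Sym2 V) | G.IsFlat F}).toFinset

/-- `c(F)`: the number of connected components of the graph with vertex set `V` and
edge set `F`. -/
noncomputable def numComponents {V : Type*} (F : Set (Sym2 V)) : ℕ :=
  Nat.card (fromEdgeSet F).ConnectedComponent

/-- The contraction `G / F`: the vertices are the connected components of the graph `(V, F)`, two
different ones being adjacent when an edge of `G` joins them. (Parallel edges are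
merged, as usual for simple graphs; in an acyclic orientation they all point the same way.) -/
def contract {V : Type*} (G : SimpleGraph V) (F : Set (Sym2 V)) :
    SimpleGraph (fromEdgeSet F).ConnectedComponent where
  Adj c d := c ≠ d ∧ ∃ v w : V, v ∈ c.supp ∧ w ∈ d.supp ∧ G.Adj v w
  symm := ⟨fun _ _ ⟨h, v, w, hv, hw, a⟩ => ⟨h.symm, w, v, hw, hv, a.symm⟩⟩
  loopless := ⟨fun _ h => h.1 rfl⟩

/-- `D` is an orientation of `G`: it chooses exactly one direction of every edge of `G` and has
no other arcs. -/
def IsOrientation {V : Type*} (G : SimpleGraph V) (D : Digraph V) : Prop :=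
  (∀ v w, G.Adj v w ↔ D.Adj v w ∨ D.Adj w v) ∧ ∀ v w, D.Adj v w → ¬ D.Adj w v

/-- `a(G)`: the number of orientations of `G` without directed cycles, that is, such that
no vertex can be reached from itself along a nonempty directed path. -/
noncomputable def numAcyclicOrientations {V : Type*} (G : SimpleGraph V) : ℕ :=
  Nat.card {D : Digraph V // G.IsOrientation D ∧ ∀ v, ¬ Relation.TransGen D.Adj v v}

end SimpleGraph

/-! ### Simplicial complexes -/

namespace AbstractSimplicialComplex

variable {V W X : Type*}

/-- The 1-skeleton of a simplicial complex, as a simple graph. -/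
def oneSkeleton (K : AbstractSimplicialComplex V) : SimpleGraph V where
  Adj v w := v ≠ w ∧ ∃ s ∈ K.faces, (s : Set V) = {v, w}
  symm := ⟨fun v w ⟨h, s, hs, e⟩ => ⟨h.symm, s, hs, e.trans (Set.pair_comm v w)⟩⟩
  loopless := ⟨fun _ h => h.1 rfl⟩

/-- The complex on `W` obtained by pulling back along an injection `W ↪ V`. -/
def comap (K : AbstractSimplicialComplex V) (f : W ↪ V) : AbstractSimplicialComplex W where
  faces := {s | s.map f ∈ K.faces}
  isRelLowerSet_faces := fun s hs =>
    ⟨Finset.map_nonempty.mp (K.isRelLowerSet_faces hs).1, fun _ hts ht =>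
      (K.isRelLowerSet_faces hs).2 (Finset.map_subset_map.mpr hts) (Finset.map_nonempty.mpr ht)⟩
  singleton_mem v := by simpa using K.singleton_mem (f v)

/-- The induced complex on a set `T` of vertices: its faces are the faces of `K` inside `T`. -/
def induce (K : AbstractSimplicialComplex V) (T : Finset V) : AbstractSimplicialComplex T :=
  K.comap (Function.Embedding.subtype (· ∈ T))

/-- The disjoint union of two complexes. -/
def disjUnion (K : AbstractSimplicialComplex V) (L : AbstractSimplicialComplex W) :
    AbstractSimplicialComplex (V ⊕ W) where
  faces := (fun s => s.map Function.Embedding.inl) '' K.faces ∪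
    (fun s => s.map Function.Embedding.inr) '' L.faces
  isRelLowerSet_faces := by
    rintro _ (⟨s, hs, rfl⟩ | ⟨s, hs, rfl⟩)
    · refine ⟨Finset.map_nonempty.mpr (K.isRelLowerSet_faces hs).1, fun t hts ht => ?_⟩
      obtain ⟨u, hu, rfl⟩ := Finset.subset_map_iff.mp hts
      exact Or.inl ⟨u, (K.isRelLowerSet_faces hs).2 hu (Finset.map_nonempty.mp ht), rfl⟩
    · refine ⟨Finset.map_nonempty.mpr (L.isRelLowerSet_faces hs).1, fun t hts ht => ?_⟩
      obtain ⟨u, hu, rfl⟩ := Finset.subset_map_iff.mp hts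
      exact Or.inr ⟨u, (L.isRelLowerSet_faces hs).2 hu (Finset.map_nonempty.mp ht), rfl⟩
  singleton_mem v := by
    rcases v with v | v
    · exact Or.inl ⟨{v}, K.singleton_mem v, rfl⟩
    · exact Or.inr ⟨{v}, L.singleton_mem v, rfl⟩

/-- Two complexes are isomorphic if a bijection of the vertices matches the faces. -/
def Iso (K : AbstractSimplicialComplex V) (L : AbstractSimplicialComplex W) : Prop :=
  ∃ e : V ≃ W, ∀ s : Finset V, s ∈ K.faces ↔ s.map e.toEmbedding ∈ L.faces

theorem Iso.refl (K : AbstractSimplicialComplex V) : K.Iso K :=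
  ⟨Equiv.refl V, fun s => by simp⟩

theorem Iso.symm {K : AbstractSimplicialComplex V} {L : AbstractSimplicialComplex W}
    (h : K.Iso L) : L.Iso K := by
  obtain ⟨e, he⟩ := h
  refine ⟨e.symm, fun s => ?_⟩
  rw [he, Finset.map_map]
  simp

theorem Iso.trans {K : AbstractSimplicialComplex V} {L : AbstractSimplicialComplex W}
    {M : AbstractSimplicialComplex X} (h : K.Iso L) (h' : L.Iso M) : K.Iso M := by
  obtain ⟨e, he⟩ := h
  obtain ⟨e', he'⟩ := h'
  refine ⟨e.trans e', fun s => ?_⟩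
  rw [he, he', Finset.map_map]
  rfl

theorem Iso.of_maps {K : AbstractSimplicialComplex V} {L : AbstractSimplicialComplex W}
    (e : V ≃ W) (h : ∀ s ∈ K.faces, s.map e.toEmbedding ∈ L.faces)
    (h' : ∀ s ∈ L.faces, s.map e.symm.toEmbedding ∈ K.faces) : K.Iso L := by
  refine ⟨e, fun s => ⟨h s, fun hs => ?_⟩⟩
  have := h' _ hs
  rwa [Finset.map_map, show e.toEmbedding.trans e.symm.toEmbedding = Function.Embedding.refl V from
    by ext; simp, Finset.map_refl] at this

theorem comap_comap (K : AbstractSimplicialComplex V) (f : W ↪ V) (g : X ↪ W) :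
    (K.comap f).comap g = K.comap (g.trans f) := by
  ext s
  simp [comap, Finset.map_map]

theorem comap_iso_of_range_eq {W' : Type*} (K : AbstractSimplicialComplex V) (f : W ↪ V)
    (g : W' ↪ V) (h : Set.range f = Set.range g) : (K.comap f).Iso (K.comap g) := by
  let e : W ≃ W' := (Equiv.ofInjective f f.injective).trans
    ((Equiv.setCongr h).trans (Equiv.ofInjective g g.injective).symm)
  have he : e.toEmbedding.trans g = f := by
    ext w
    exact Equiv.apply_ofInjective_symm g.injective _
  refine ⟨e, fun s => ?_⟩
  change s.map f ∈ K.faces ↔ (s.map e.toEmbedding).map g ∈ K.faces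
  rw [Finset.map_map, he]

theorem iso_comap_equiv (K : AbstractSimplicialComplex V) (e : W ≃ V) :
    (K.comap e.toEmbedding).Iso K := ⟨e, fun _ => Iff.rfl⟩

theorem Iso.eq_comap {K : AbstractSimplicialComplex V} {L : AbstractSimplicialComplex W}
    (h : K.Iso L) : ∃ e : V ≃ W, K = L.comap e.toEmbedding := by
  obtain ⟨e, he⟩ := h
  exact ⟨e, by ext s; exact he s⟩

theorem iso_of_isEmpty [IsEmpty V] [IsEmpty W] (K : AbstractSimplicialComplex V)
    (L : AbstractSimplicialComplex W) : K.Iso L := by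
  refine .of_maps (Equiv.equivOfIsEmpty V W) (fun s hs => ?_) (fun s hs => ?_)
  · exact absurd (K.isRelLowerSet_faces hs).1 (by simp [Finset.eq_empty_of_isEmpty s])
  · exact absurd (L.isRelLowerSet_faces hs).1 (by simp [Finset.eq_empty_of_isEmpty s])

theorem Iso.disjUnion {V' W' : Type*} {K : AbstractSimplicialComplex V}
    {L : AbstractSimplicialComplex W} {K' : AbstractSimplicialComplex V'}
    {L' : AbstractSimplicialComplex W'} (hK : K.Iso K') (hL : L.Iso L') :
    (K.disjUnion L).Iso (K'.disjUnion L') := by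
  obtain ⟨e, he⟩ := hK
  obtain ⟨f, hf⟩ := hL
  refine .of_maps (Equiv.sumCongr e f) ?_ ?_
  · rintro _ (⟨s, hs, rfl⟩ | ⟨s, hs, rfl⟩)
    · exact Or.inl ⟨_, (he s).mp hs, by simp only [Finset.map_map]; rfl⟩
    · exact Or.inr ⟨_, (hf s).mp hs, by simp only [Finset.map_map]; rfl⟩
  · rintro _ (⟨s, hs, rfl⟩ | ⟨s, hs, rfl⟩)
    · exact Or.inl ⟨s.map e.symm.toEmbedding, (he _).mpr (by simpa [Finset.map_map] using hs),
        by simp only [Finset.map_map]; rfl⟩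
    · exact Or.inr ⟨s.map f.symm.toEmbedding, (hf _).mpr (by simpa [Finset.map_map] using hs),
        by simp only [Finset.map_map]; rfl⟩

theorem disjUnion_comm_iso (K : AbstractSimplicialComplex V) (L : AbstractSimplicialComplex W) :
    (K.disjUnion L).Iso (L.disjUnion K) := by
  refine .of_maps (Equiv.sumComm V W) ?_ ?_
  · rintro _ (⟨s, hs, rfl⟩ | ⟨s, hs, rfl⟩)
    · exact Or.inr ⟨s, hs, by simp only [Finset.map_map]; rfl⟩
    · exact Or.inl ⟨s, hs, by simp only [Finset.map_map]; rfl⟩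
  · rintro _ (⟨s, hs, rfl⟩ | ⟨s, hs, rfl⟩)
    · exact Or.inr ⟨s, hs, by simp only [Finset.map_map]; rfl⟩
    · exact Or.inl ⟨s, hs, by simp only [Finset.map_map]; rfl⟩

theorem disjUnion_assoc_iso (K : AbstractSimplicialComplex V) (L : AbstractSimplicialComplex W)
    (M : AbstractSimplicialComplex X) :
    ((K.disjUnion L).disjUnion M).Iso (K.disjUnion (L.disjUnion M)) := by
  refine .of_maps (Equiv.sumAssoc V W X) ?_ ?_
  · rintro _ (⟨_, ⟨s, hs, rfl⟩ | ⟨s, hs, rfl⟩, rfl⟩ | ⟨s, hs, rfl⟩)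
    · exact Or.inl ⟨s, hs, by simp only [Finset.map_map]; rfl⟩
    · exact Or.inr ⟨_, Or.inl ⟨s, hs, rfl⟩, by simp only [Finset.map_map]; rfl⟩
    · exact Or.inr ⟨_, Or.inr ⟨s, hs, rfl⟩, by simp only [Finset.map_map]; rfl⟩
  · rintro _ (⟨s, hs, rfl⟩ | ⟨_, ⟨s, hs, rfl⟩ | ⟨s, hs, rfl⟩, rfl⟩)
    · exact Or.inl ⟨_, Or.inl ⟨s, hs, rfl⟩, by simp only [Finset.map_map]; rfl⟩
    · exact Or.inl ⟨_, Or.inr ⟨s, hs, rfl⟩, by simp only [Finset.map_map]; rfl⟩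
    · exact Or.inr ⟨s, hs, by simp only [Finset.map_map]; rfl⟩

theorem disjUnion_empty_iso [IsEmpty W] (K : AbstractSimplicialComplex V)
    (L : AbstractSimplicialComplex W) : (K.disjUnion L).Iso K := by
  refine .of_maps (Equiv.sumEmpty V W) ?_ ?_
  · rintro _ (⟨s, hs, rfl⟩ | ⟨s, hs, rfl⟩)
    · rw [Finset.map_map]
      convert hs
      ext; simp
    · exact absurd (L.isRelLowerSet_faces hs).1 (by simp [Finset.eq_empty_of_isEmpty s])
  · intro s hs
    exact Or.inl ⟨s, hs, rfl⟩

theorem induce_disjUnion_iso (K : AbstractSimplicialComplex V) (L : AbstractSimplicialComplex W)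
    (S : Finset V) (T : Finset W) :
    ((K.disjUnion L).induce (S.disjSum T)).Iso ((K.induce S).disjUnion (L.induce T)) := by
  let f : S ⊕ T ↪ V ⊕ W := Function.Embedding.sumMap (Function.Embedding.subtype (· ∈ S))
    (Function.Embedding.subtype (· ∈ T))
  have h : (K.induce S).disjUnion (L.induce T) = (K.disjUnion L).comap f := by
    ext s
    constructor
    · rintro (⟨s, hs, rfl⟩ | ⟨s, hs, rfl⟩)
      · exact Or.inl ⟨_, hs, by simp only [Finset.map_map]; rfl⟩
      · exact Or.inr ⟨_, hs, by simp only [Finset.map_map]; rfl⟩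
    · have key := (Finset.toLeft_disjSum_toRight (u := s))
      rintro (⟨t, ht, hts⟩ | ⟨t, ht, hts⟩)
      · have hr : s.toRight = ∅ := by
          refine Finset.eq_empty_of_forall_notMem fun x hx => ?_
          have : f (Sum.inr x) ∈ s.map f := Finset.mem_map_of_mem _ (Finset.mem_toRight.mp hx)
          rw [← hts] at this
          simp [f] at this
        rw [hr, Finset.disjSum_empty] at key
        refine Or.inl ⟨s.toLeft, ?_, key⟩
        change s.toLeft.map _ ∈ K.faces
        convert ht
        apply Finset.map_injective (Function.Embedding.inl : V ↪ V ⊕ W)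
        dsimp only at hts
        refine Eq.trans ?_ hts.symm
        conv_rhs => rw [← key]
        simp only [Finset.map_map]
        rfl
      · have hr : s.toLeft = ∅ := by
          refine Finset.eq_empty_of_forall_notMem fun x hx => ?_
          have : f (Sum.inl x) ∈ s.map f := Finset.mem_map_of_mem _ (Finset.mem_toLeft.mp hx)
          rw [← hts] at this
          simp [f] at this
        rw [hr, Finset.empty_disjSum] at key
        refine Or.inr ⟨s.toRight, ?_, key⟩
        change s.toRight.map _ ∈ L.faces
        convert ht
        apply Finset.map_injective (Function.Embedding.inr : W ↪ V ⊕ W)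
        dsimp only at hts
        refine Eq.trans ?_ hts.symm
        conv_rhs => rw [← key]
        simp only [Finset.map_map]
        rfl
  rw [h]
  refine comap_iso_of_range_eq _ _ _ ?_
  ext x
  rcases x with x | x <;> simp [f]

instance isoSetoid : Setoid (Σ n : ℕ, AbstractSimplicialComplex (Fin n)) where
  r p q := p.2.Iso q.2
  iseqv := ⟨fun p => Iso.refl p.2, fun h => Iso.symm h, fun h h' => Iso.trans h h'⟩

end AbstractSimplicialComplex

open AbstractSimplicialComplex

/-- The isomorphism classes of finite simplicial complexes (each has a representative on some
`Fin n`). -/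
def ComplexClass : Type := Quotient AbstractSimplicialComplex.isoSetoid

namespace ComplexClass

/-- The isomorphism class `[K]` of a simplicial complex on a finite vertex set. -/
noncomputable def mk {V : Type*} [Finite V] (K : AbstractSimplicialComplex V) : ComplexClass :=
  Quotient.mk _ ⟨Nat.card V, K.comap (Finite.equivFin V).symm.toEmbedding⟩

theorem mk_eq_iff {V W : Type*} [Finite V] [Finite W] {K : AbstractSimplicialComplex V}
    {L : AbstractSimplicialComplex W} : mk K = mk L ↔ K.Iso L := by
  refine Quotient.eq.trans ⟨fun h => ?_, fun h => ?_⟩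
  · exact ((iso_comap_equiv K _).symm.trans h).trans (iso_comap_equiv L _)
  · exact ((iso_comap_equiv K _).trans h).trans (iso_comap_equiv L _).symm

theorem mk_fin {n : ℕ} (K : AbstractSimplicialComplex (Fin n)) :
    (Quotient.mk _ ⟨n, K⟩ : ComplexClass) = mk K :=
  Quotient.sound (iso_comap_equiv K _).symm

theorem ind {p : ComplexClass → Prop}
    (h : ∀ (n : ℕ) (K : AbstractSimplicialComplex (Fin n)), p (mk K)) (x : ComplexClass) : p x := by
  induction x using Quotient.inductionOn with
  | h a =>
    obtain ⟨n, K⟩ := a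
    rw [mk_fin]
    exact h n K

/-- The number of vertices. -/
def degree : ComplexClass → ℕ :=
  Quotient.lift Sigma.fst fun p q (h : p.2.Iso q.2) => by
    obtain ⟨e, -⟩ := h
    simpa using Fintype.card_congr e

theorem degree_mk {V : Type*} [Finite V] (K : AbstractSimplicialComplex V) :
    (mk K).degree = Nat.card V := rfl

/-- Disjoint union of isomorphism classes. -/
noncomputable instance : Mul ComplexClass where
  mul := Quotient.lift₂ (fun p q => mk (p.2.disjUnion q.2))
    fun _ _ _ _ h h' => mk_eq_iff.mpr (Iso.disjUnion h h')

/-- The class of the complex without vertices. -/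
noncomputable instance : One ComplexClass where
  one := mk (⊥ : AbstractSimplicialComplex (Fin 0))

theorem mk_mul_mk {V W : Type*} [Finite V] [Finite W] (K : AbstractSimplicialComplex V)
    (L : AbstractSimplicialComplex W) : mk K * mk L = mk (K.disjUnion L) :=
  mk_eq_iff.mpr ((iso_comap_equiv K _).disjUnion (iso_comap_equiv L _))

theorem mk_eq_one {V : Type*} [Finite V] [IsEmpty V] (K : AbstractSimplicialComplex V) :
    mk K = 1 :=
  mk_eq_iff.mpr (iso_of_isEmpty K _)

theorem degree_eq_zero_iff {x : ComplexClass} : x.degree = 0 ↔ x = 1 := by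
  constructor
  · induction x using ind with
    | h n K =>
      intro h
      have : n = 0 := by simpa [degree_mk] using h
      subst this
      exact mk_eq_one K
  · rintro rfl
    exact (degree_mk _).trans (by simp)

noncomputable instance : CommMonoid ComplexClass where
  mul_assoc x y z := by
    induction x using ind with
    | h _ K =>
    induction y using ind with
    | h _ L =>
    induction z using ind with
    | h _ M =>
    simp only [mk_mul_mk]
    exact mk_eq_iff.mpr (disjUnion_assoc_iso K L M)
  mul_comm x y := by
    induction x using ind with
    | h _ K =>
    induction y using ind with
    | h _ L =>
    simp only [mk_mul_mk]
    exact mk_eq_iff.mpr (disjUnion_comm_iso K L)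
  mul_one x := by
    induction x using ind with
    | h _ K => exact (mk_mul_mk K _).trans (mk_eq_iff.mpr (disjUnion_empty_iso K _))
  one_mul x := by
    induction x using ind with
    | h _ K =>
      exact (mk_mul_mk _ K).trans (mk_eq_iff.mpr
        ((disjUnion_comm_iso _ K).trans (disjUnion_empty_iso K _)))

theorem degree_mul (x y : ComplexClass) : (x * y).degree = x.degree + y.degree := by
  induction x using ind with
  | h _ K =>
  induction y using ind with
  | h _ L =>
  simp [mk_mul_mk, degree_mk]

theorem mk_induce_univ {V : Type*} [Fintype V] (K : AbstractSimplicialComplex V) :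
    mk (K.induce Finset.univ) = mk K := by
  refine mk_eq_iff.mpr ((comap_iso_of_range_eq K _ (Equiv.refl V).toEmbedding ?_).trans
    (iso_comap_equiv K _))
  ext x
  simp

theorem mk_induce_empty {V : Type*} (K : AbstractSimplicialComplex V) :
    mk (K.induce ∅) = 1 := mk_eq_one _

/-- Inducing twice. -/
theorem mk_induce_induce {V : Type*} (K : AbstractSimplicialComplex V) (T : Finset V)
    (U : Finset T) (S : Finset V) (h : U.map (Function.Embedding.subtype _) = S) :
    mk ((K.induce T).induce U) = mk (K.induce S) := by
  subst h
  rw [induce, induce, comap_comap]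
  refine mk_eq_iff.mpr (comap_iso_of_range_eq K _ _ ?_)
  ext x
  simp

end ComplexClass

/-! ### The Hopf algebra of simplicial complexes -/

/-- The algebra of finite simplicial complexes over `𝕜`: the vector space whose basis is the set of
isomorphism classes, with disjoint union as multiplication. -/
def ComplexAlgebra (𝕜 : Type*) [Field 𝕜] : Type _ := MonoidAlgebra 𝕜 ComplexClass

namespace ComplexAlgebra

variable (𝕜 : Type*) [Field 𝕜]

noncomputable instance : CommRing (ComplexAlgebra 𝕜) :=
  inferInstanceAs (CommRing (MonoidAlgebra 𝕜 ComplexClass))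

noncomputable instance : Algebra 𝕜 (ComplexAlgebra 𝕜) :=
  inferInstanceAs (Algebra 𝕜 (MonoidAlgebra 𝕜 ComplexClass))

/-- The basis element of an isomorphism class. -/
noncomputable def single : ComplexClass →* ComplexAlgebra 𝕜 := MonoidAlgebra.of 𝕜 ComplexClass

/-- The basis element `[K]`. -/
noncomputable def basis {V : Type*} [Finite V] (K : AbstractSimplicialComplex V) :
    ComplexAlgebra 𝕜 := single 𝕜 (ComplexClass.mk K)

/-- The coefficients of an element in the basis of isomorphism classes. -/
def coeffs (x : ComplexAlgebra 𝕜) : ComplexClass →₀ 𝕜 := MonoidAlgebra.coeff x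

/-- The (finite) sum of the coefficients of an element in the basis of isomorphism classes. -/
def coeffSum (x : ComplexAlgebra 𝕜) : 𝕜 := (coeffs 𝕜 x).sum fun _ r => r

/-- The linear map with prescribed values on the basis. -/
noncomputable def liftLinear {M : Type*} [AddCommGroup M] [Module 𝕜 M] (f : ComplexClass → M) :
    ComplexAlgebra 𝕜 →ₗ[𝕜] M :=
  Finsupp.linearCombination 𝕜 f ∘ₗ
    (MonoidAlgebra.coeffLinearEquiv 𝕜 :
      MonoidAlgebra 𝕜 ComplexClass ≃ₗ[𝕜] ComplexClass →₀ 𝕜).toLinearMap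

theorem liftLinear_single {M : Type*} [AddCommGroup M] [Module 𝕜 M] (f : ComplexClass → M)
    (x : ComplexClass) : liftLinear 𝕜 f (single 𝕜 x) = f x := by
  change Finsupp.linearCombination 𝕜 f (Finsupp.single x 1) = f x
  simp

/-- The algebra homomorphism with prescribed multiplicative values on the basis. -/
noncomputable def liftAlg {B : Type*} [CommRing B] [Algebra 𝕜 B] (f : ComplexClass →* B) :
    ComplexAlgebra 𝕜 →ₐ[𝕜] B := MonoidAlgebra.lift 𝕜 B ComplexClass f

theorem liftAlg_single {B : Type*} [CommRing B] [Algebra 𝕜 B] (f : ComplexClass →* B)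
    (x : ComplexClass) : liftAlg 𝕜 f (single 𝕜 x) = f x :=
  MonoidAlgebra.lift_of f x

variable {𝕜} in
theorem linearMap_ext {M : Type*} [AddCommGroup M] [Module 𝕜 M]
    {f g : ComplexAlgebra 𝕜 →ₗ[𝕜] M}
    (h : ∀ (n : ℕ) (K : AbstractSimplicialComplex (Fin n)), f (basis 𝕜 K) = g (basis 𝕜 K)) :
    f = g := by
  have hx : ∀ x, f (single 𝕜 x) = g (single 𝕜 x) := fun x => by
    induction x using ComplexClass.ind with
    | h n K => exact h n K
  refine LinearMap.ext fun a => ?_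
  induction a using MonoidAlgebra.induction_on with
  | of x => exact hx x
  | add a b ha hb => exact (map_add f a b).trans ((congrArg₂ _ ha hb).trans (map_add g a b).symm)
  | smul r a ha => exact (map_smul f r a).trans ((congrArg _ ha).trans (map_smul g r a).symm)

variable {𝕜} in
theorem algHom_ext {B : Type*} [CommRing B] [Algebra 𝕜 B] {f g : ComplexAlgebra 𝕜 →ₐ[𝕜] B}
    (h : ∀ (n : ℕ) (K : AbstractSimplicialComplex (Fin n)), f (basis 𝕜 K) = g (basis 𝕜 K)) :
    f = g :=
  AlgHom.toLinearMap_injective (linearMap_ext h)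

/-- `∑_{T ⊆ V} [K_T] ⊗ [K_{V - T}]`. -/
noncomputable def comulSum {V : Type*} [Fintype V] [DecidableEq V]
    (K : AbstractSimplicialComplex V) : ComplexAlgebra 𝕜 ⊗[𝕜] ComplexAlgebra 𝕜 :=
  ∑ T : Finset V, basis 𝕜 (K.induce T) ⊗ₜ[𝕜] basis 𝕜 (K.induce Tᶜ)

theorem comulSum_congr {V W : Type*} [Fintype V] [DecidableEq V] [Fintype W] [DecidableEq W]
    {K : AbstractSimplicialComplex V} {L : AbstractSimplicialComplex W} (h : K.Iso L) :
    comulSum 𝕜 K = comulSum 𝕜 L := by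
  obtain ⟨e, rfl⟩ := h.eq_comap
  refine Fintype.sum_equiv e.finsetCongr _ _ fun T => ?_
  have aux : ∀ (T : Finset V) (S : Finset W), (∀ w, w ∈ S ↔ e.symm w ∈ T) →
      basis 𝕜 ((L.comap e.toEmbedding).induce T) = basis 𝕜 (L.induce S) := fun T S hTS => by
    refine congrArg (single 𝕜) (ComplexClass.mk_eq_iff.mpr ?_)
    rw [induce, comap_comap]
    refine comap_iso_of_range_eq _ _ _ ?_
    ext w
    simp [hTS, ← e.eq_symm_apply]
  rw [aux T (e.finsetCongr T) fun w => by simp,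
    aux Tᶜ (e.finsetCongr T)ᶜ fun w => by simp]

/-- The coproduct on basis elements. -/
noncomputable def comulBasis : ComplexClass → ComplexAlgebra 𝕜 ⊗[𝕜] ComplexAlgebra 𝕜 :=
  Quotient.lift (fun p => comulSum 𝕜 p.2) fun _ _ h => comulSum_congr 𝕜 h

theorem comulBasis_mk {V : Type*} [Fintype V] [DecidableEq V]
    (K : AbstractSimplicialComplex V) : comulBasis 𝕜 (ComplexClass.mk K) = comulSum 𝕜 K :=
  comulSum_congr 𝕜 (iso_comap_equiv K _)

theorem comulBasis_one : comulBasis 𝕜 1 = 1 := by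
  refine (comulBasis_mk 𝕜 _).trans ?_
  simp only [comulSum, basis]
  simp [ComplexClass.mk_eq_one, Algebra.TensorProduct.one_def]

theorem comulBasis_mul (x y : ComplexClass) :
    comulBasis 𝕜 (x * y) = comulBasis 𝕜 x * comulBasis 𝕜 y := by
  induction x using ComplexClass.ind with
  | h _ K =>
  induction y using ComplexClass.ind with
  | h _ L =>
  rw [ComplexClass.mk_mul_mk, comulBasis_mk, comulBasis_mk, comulBasis_mk, comulSum, comulSum,
    comulSum, Finset.sum_mul_sum, ← Fintype.sum_prod_type']
  refine (Fintype.sum_equiv Finset.sumEquiv.symm.toEquiv _ _ fun p => ?_).symm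
  have hc : (p.1.disjSum p.2)ᶜ = p.1ᶜ.disjSum p.2ᶜ := by
    ext x
    rcases x with x | x <;> simp
  have aux := fun S T => congrArg (single 𝕜)
    ((ComplexClass.mk_eq_iff.mpr (induce_disjUnion_iso K L S T)).trans
      (ComplexClass.mk_mul_mk _ _).symm)
  change _ = basis 𝕜 ((K.disjUnion L).induce (p.1.disjSum p.2)) ⊗ₜ
    basis 𝕜 ((K.disjUnion L).induce (p.1.disjSum p.2)ᶜ)
  rw [hc, Algebra.TensorProduct.tmul_mul_tmul]
  simp only [basis, aux, map_mul]

/-- The coproduct `[K] ↦ ∑_{T ⊆ V} [K_T] ⊗ [K_{V - T}]`. -/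
noncomputable def comulHom : ComplexAlgebra 𝕜 →ₐ[𝕜] ComplexAlgebra 𝕜 ⊗[𝕜] ComplexAlgebra 𝕜 :=
  liftAlg 𝕜 ⟨⟨comulBasis 𝕜, comulBasis_one 𝕜⟩, comulBasis_mul 𝕜⟩

open Classical in
/-- The counit: `1` on the class of the complex without vertices, `0` on all other classes. -/
noncomputable def counitHom : ComplexAlgebra 𝕜 →ₐ[𝕜] 𝕜 :=
  liftAlg 𝕜
    { toFun := fun x => if x = 1 then 1 else 0
      map_one' := if_pos rfl
      map_mul' := fun x y => by
        simp only [← ComplexClass.degree_eq_zero_iff, ComplexClass.degree_mul, Nat.add_eq_zero_iff]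
        split_ifs <;> simp_all }

theorem comulHom_basis {V : Type*} [Fintype V] [DecidableEq V]
    (K : AbstractSimplicialComplex V) :
    comulHom 𝕜 (basis 𝕜 K) =
      ∑ T : Finset V, basis 𝕜 (K.induce T) ⊗ₜ[𝕜] basis 𝕜 (K.induce Tᶜ) :=
  (liftAlg_single 𝕜 _ _).trans (comulBasis_mk 𝕜 K)

theorem counitHom_basis {V : Type*} [Fintype V] (K : AbstractSimplicialComplex V) :
    counitHom 𝕜 (basis 𝕜 K) = if Fintype.card V = 0 then 1 else 0 := by
  refine (liftAlg_single 𝕜 _ _).trans ?_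
  simp [← ComplexClass.degree_eq_zero_iff, ComplexClass.degree_mk]

theorem basis_congr {V : Type*} (K : AbstractSimplicialComplex V) {S T : Finset V} (h : S = T) :
    basis 𝕜 (K.induce S) = basis 𝕜 (K.induce T) := by
  subst h
  rfl

theorem basis_induce_univ {V : Type*} [Fintype V] (K : AbstractSimplicialComplex V) :
    basis 𝕜 (K.induce Finset.univ) = basis 𝕜 K :=
  congrArg (single 𝕜) (ComplexClass.mk_induce_univ K)

theorem basis_induce_empty {V : Type*} (K : AbstractSimplicialComplex V) :
    basis 𝕜 (K.induce ∅) = 1 :=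
  (congrArg (single 𝕜) (ComplexClass.mk_induce_empty K)).trans (map_one _)

/-- The coproduct of an induced complex, in terms of induced complexes of the big one. -/
theorem comulHom_induce {V : Type*} [DecidableEq V] (K : AbstractSimplicialComplex V)
    (T : Finset V) :
    comulHom 𝕜 (basis 𝕜 (K.induce T)) =
      ∑ U ∈ T.powerset, basis 𝕜 (K.induce U) ⊗ₜ[𝕜] basis 𝕜 (K.induce (T \ U)) := by
  rw [comulHom_basis]
  refine Finset.sum_bij (fun U _ => U.map (Function.Embedding.subtype _)) (fun U _ => ?_)
    (fun U _ U' _ h => Finset.map_injective _ h) (fun U hU => ?_) (fun U _ => ?_)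
  · rw [Finset.mem_powerset]
    intro x hx
    obtain ⟨y, -, rfl⟩ := Finset.mem_map.mp hx
    exact y.2
  · refine ⟨U.subtype (· ∈ T), Finset.mem_univ _, ?_⟩
    exact Finset.subtype_map_of_mem fun x hx => Finset.mem_powerset.mp hU hx
  · congr 1
    · exact congrArg (single 𝕜) (ComplexClass.mk_induce_induce K T U _ rfl)
    · refine congrArg (single 𝕜) (ComplexClass.mk_induce_induce K T _ _ ?_)
      ext x
      by_cases hx : x ∈ T <;> simp [hx]

noncomputable instance : Bialgebra 𝕜 (ComplexAlgebra 𝕜) :=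
  Bialgebra.ofAlgHom (comulHom 𝕜) (counitHom 𝕜)
    (algHom_ext fun n K => by
      simp only [AlgHom.comp_apply]
      rw [comulHom_basis]
      simp only [map_sum, Algebra.TensorProduct.map_tmul,
        comulHom_induce, TensorProduct.sum_tmul, TensorProduct.tmul_sum, AlgHom.id_apply,
        AlgEquiv.coe_toAlgHom, Algebra.TensorProduct.assoc_tmul]
      rw [Finset.sum_sigma', Finset.sum_sigma']
      refine Finset.sum_bij' (fun p _ => ⟨p.2, p.1 \ p.2⟩) (fun p _ => ⟨p.1 ∪ p.2, p.1⟩)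
        ?_ ?_ ?_ ?_ ?_
      · rintro ⟨T, U⟩ h
        simp only [Finset.mem_sigma, Finset.mem_univ, Finset.mem_powerset, true_and] at h ⊢
        intro x hx
        simp_all
      · rintro ⟨T, U⟩ h
        exact Finset.mem_sigma.mpr ⟨Finset.mem_univ _,
          Finset.mem_powerset.mpr Finset.subset_union_left⟩
      · rintro ⟨T, U⟩ h
        simp only [Finset.mem_sigma, Finset.mem_univ, Finset.mem_powerset, true_and] at h
        simp [Finset.union_sdiff_of_subset h]
      · rintro ⟨T, U⟩ h
        simp only [Finset.mem_sigma, Finset.mem_univ, Finset.mem_powerset, true_and] at h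
        have : Disjoint U T := Finset.subset_compl_iff_disjoint_right.mp h
        simp [Finset.union_sdiff_cancel_left this.symm]
      · rintro ⟨T, U⟩ h
        simp only [Finset.mem_sigma, Finset.mem_univ, Finset.mem_powerset, true_and] at h
        have : Uᶜ \ (T \ U) = Tᶜ := by
          ext x
          have := @h x
          simp
          tauto
        rw [this])
    (algHom_ext fun n K => by
      simp only [AlgHom.comp_apply, comulHom_basis, map_sum, Algebra.TensorProduct.map_tmul,
        counitHom_basis, AlgHom.id_apply]
      rw [Finset.sum_eq_single ∅ (fun T _ hT => by simp [hT]) (by simp)]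
      simp [basis_congr 𝕜 K Finset.compl_empty, basis_induce_univ])
    (algHom_ext fun n K => by
      simp only [AlgHom.comp_apply, comulHom_basis, map_sum, Algebra.TensorProduct.map_tmul,
        counitHom_basis, AlgHom.id_apply]
      rw [Finset.sum_eq_single Finset.univ (fun T _ hT => by
        rw [if_neg (by
          rw [Fintype.card_coe, Finset.card_eq_zero, Finset.compl_eq_empty_iff]
          exact hT),
          TensorProduct.tmul_zero]) (by simp)]
      simp [basis_induce_univ])

theorem degree_out (x : ComplexClass) : x.out.1 = x.degree := by
  conv_rhs => rw [← Quotient.out_eq x]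
  rfl

/-- The antipode on basis elements, by the usual recursion in a connected graded bialgebra:
`S(∅) = 1`, and `S([K]) = - ∑_{T ≠ V} S([K_T]) [K_{V - T}]` if `K` has vertices. -/
noncomputable def antipodeBasis (x : ComplexClass) : ComplexAlgebra 𝕜 :=
  if x.degree = 0 then 1 else
    - ∑ T : {T : Finset (Fin x.out.1) // T ≠ Finset.univ},
        antipodeBasis (ComplexClass.mk (x.out.2.induce T.1)) * basis 𝕜 (x.out.2.induce T.1ᶜ)
termination_by x.degree
decreasing_by
  rw [ComplexClass.degree_mk, Nat.card_eq_fintype_card, Fintype.card_coe, ← degree_out]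
  exact (Finset.card_lt_card (Finset.ssubset_univ_iff.mpr T.2)).trans_eq (by simp)

/-- The antipode. -/
noncomputable def antipodeLinear : ComplexAlgebra 𝕜 →ₗ[𝕜] ComplexAlgebra 𝕜 :=
  liftLinear 𝕜 (antipodeBasis 𝕜)

theorem sum_antipode_mul (x : ComplexClass) :
    ∑ T : Finset (Fin x.out.1),
      antipodeLinear 𝕜 (basis 𝕜 (x.out.2.induce T)) * basis 𝕜 (x.out.2.induce Tᶜ) =
      if x.out.1 = 0 then 1 else 0 := by
  have hx : ComplexClass.mk x.out.2 = x := (ComplexClass.mk_fin _).symm.trans (Quotient.out_eq x)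
  have hS : ∀ y, antipodeLinear 𝕜 (single 𝕜 y) = antipodeBasis 𝕜 y := liftLinear_single 𝕜 _
  rw [← Finset.add_sum_erase _ _ (Finset.mem_univ Finset.univ), Finset.compl_univ,
    basis_induce_empty, mul_one, basis_induce_univ]
  simp only [basis, hS]
  rw [hx]
  conv_lhs => enter [1]; rw [antipodeBasis]
  simp only [degree_out]
  split_ifs with h
  · rw [add_eq_left, Finset.sum_eq_zero]
    intro T hT
    have h0 : IsEmpty (Fin x.out.1) := by rw [degree_out, h]; infer_instance
    exact absurd (Subsingleton.elim T _) (Finset.ne_of_mem_erase hT)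
  · rw [neg_add_eq_zero]
    have hs : ∀ T : Finset (Fin x.out.1),
        T ∈ Finset.univ.erase Finset.univ ↔ T ≠ Finset.univ := by simp
    exact (Finset.sum_subtype _ hs fun T =>
      antipodeBasis 𝕜 (ComplexClass.mk (x.out.2.induce T)) *
        single 𝕜 (ComplexClass.mk (x.out.2.induce Tᶜ))).symm

theorem sum_antipode_mul_fin (n : ℕ) (K : AbstractSimplicialComplex (Fin n)) :
    LinearMap.mul' 𝕜 (ComplexAlgebra 𝕜)
      ((antipodeLinear 𝕜).rTensor (ComplexAlgebra 𝕜) (comulHom 𝕜 (basis 𝕜 K))) =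
      algebraMap 𝕜 (ComplexAlgebra 𝕜) (counitHom 𝕜 (basis 𝕜 K)) := by
  have hx : ComplexClass.mk (ComplexClass.mk K).out.2 = ComplexClass.mk K :=
    (ComplexClass.mk_fin _).symm.trans (Quotient.out_eq _)
  have hb : basis 𝕜 K = basis 𝕜 (ComplexClass.mk K).out.2 := congrArg (single 𝕜) hx.symm
  rw [hb, comulHom_basis, counitHom_basis]
  simp only [map_sum, LinearMap.rTensor_tmul, LinearMap.mul'_apply, Fintype.card_fin]
  rw [sum_antipode_mul]
  split_ifs <;> simp

noncomputable instance : HopfAlgebra 𝕜 (ComplexAlgebra 𝕜) where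
  antipode := antipodeLinear 𝕜
  mul_antipode_rTensor_comul := linearMap_ext fun n K => sum_antipode_mul_fin 𝕜 n K
  mul_antipode_lTensor_comul := linearMap_ext fun n K => by
    refine Eq.trans ?_ (sum_antipode_mul_fin 𝕜 n K)
    change LinearMap.mul' 𝕜 (ComplexAlgebra 𝕜)
      ((antipodeLinear 𝕜).lTensor (ComplexAlgebra 𝕜) (comulHom 𝕜 (basis 𝕜 K))) = _
    rw [comulHom_basis]
    simp only [map_sum, LinearMap.rTensor_tmul, LinearMap.lTensor_tmul, LinearMap.mul'_apply]
    refine Fintype.sum_equiv (Function.Involutive.toPerm _ compl_involutive) _ _ fun T => ?_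
    have h : basis 𝕜 (K.induce Tᶜᶜ) = basis 𝕜 (K.induce T) :=
      basis_congr 𝕜 K (compl_compl T)
    simp [mul_comm, h]

end ComplexAlgebra

/-! ### Coefficient sums of the antipode -/

namespace ComplexAlgebra

/-! Both halves rest on the recursion `∑_{T ⊆ U} f(T) = 0` for nonempty `U`, `f(∅) = 1`, whose only
solution is `f(U) = (-1)^|U|`.

Antipode: the sum of coefficients is the character sending every class to `1`. Applied to the
antipode identity at `[K]`, it shows that the coefficient sums of `S([K_T])`, added over all `T ⊆
V`, give `1` if `V` is empty and `0` otherwise. Strong induction on the number of vertices finishes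
(`coeffSum_antipode_basis`).

Graph identity: a flat `F` with an acyclic orientation of `G/F` is the same datum as a weak
orientation of `G`, in which edges may point both ways (ties) and every arc on a directed cycle is a
tie. The ties form `F`, and `c(F)` counts the components of the tie graph
(`numAcyclicOrientations_contract`). So the sum over flats is the signed number `w(V)` of weak
orientations, where `w(U)` makes sense for every vertex set `U`. Making all edges inside `T` ties
and directing all other edges meeting `T` into `T` identifies weak orientations on `U \ T` with
those on `U` for which `T` is terminal. After exchanging sums, a fixed `D` contributes a signed sum
over its terminal sets, and toggling one terminal tie component cancels it
(`IsWeakOrientation.sum_isTerminal`). Hence `w` satisfies the recursion. -/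

/-- Being an algebra homomorphism, the coefficient sum can be pushed through the products in the
antipode identity. -/
theorem coeffSum_eq_liftAlg (𝕜 : Type*) [Field 𝕜] (x : ComplexAlgebra 𝕜) :
    coeffSum 𝕜 x = liftAlg 𝕜 (1 : ComplexClass →* 𝕜) x := by
  refine Eq.trans ?_ (MonoidAlgebra.lift_apply (1 : ComplexClass →* 𝕜) x).symm
  simp [coeffSum, coeffs]

theorem sum_antipode_induce_mul (𝕜 : Type*) [Field 𝕜] {V : Type*} [Fintype V] [DecidableEq V]
    (K : AbstractSimplicialComplex V) :
    ∑ T : Finset V, HopfAlgebra.antipode 𝕜 (basis 𝕜 (K.induce T)) * basis 𝕜 (K.induce Tᶜ) =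
      algebraMap 𝕜 (ComplexAlgebra 𝕜) (if Fintype.card V = 0 then 1 else 0) := by
  have h := HopfAlgebra.mul_antipode_rTensor_comul_apply (R := 𝕜) (basis 𝕜 K)
  rw [show Coalgebra.comul (R := 𝕜) (basis 𝕜 K) = comulHom 𝕜 (basis 𝕜 K) from rfl,
    show Coalgebra.counit (R := 𝕜) (basis 𝕜 K) = counitHom 𝕜 (basis 𝕜 K) from rfl,
    comulHom_basis, counitHom_basis] at h
  simpa only [map_sum, LinearMap.rTensor_tmul, LinearMap.mul'_apply] using h

theorem liftAlg_one_basis (𝕜 : Type*) [Field 𝕜] {V : Type*} [Finite V]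
    (K : AbstractSimplicialComplex V) :
    liftAlg 𝕜 (1 : ComplexClass →* 𝕜) (basis 𝕜 K) = 1 :=
  liftAlg_single 𝕜 _ _

/-- The coefficients of the antipode of a complex with `n` vertices sum to `(-1) ^ n`. -/
theorem coeffSum_antipode_basis (𝕜 : Type*) [Field 𝕜] (n : ℕ) {V : Type*} [Fintype V]
    (K : AbstractSimplicialComplex V) (hn : Fintype.card V = n) :
    coeffSum 𝕜 (HopfAlgebra.antipode 𝕜 (basis 𝕜 K)) = (-1) ^ n := by
  classical
  induction n using Nat.strong_induction_on generalizing V with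
  | h n ih =>
    have h := congrArg (liftAlg 𝕜 (1 : ComplexClass →* 𝕜)) (sum_antipode_induce_mul 𝕜 K)
    simp only [map_sum, map_mul, liftAlg_one_basis, mul_one, AlgHom.commutes,
      Algebra.algebraMap_self, RingHom.id_apply] at h
    simp only [← coeffSum_eq_liftAlg] at h
    -- The expected values satisfy the same identity, by the alternating sum over subsets.
    have h' : ∑ T : Finset V, (-1 : 𝕜) ^ T.card = if Fintype.card V = 0 then 1 else 0 := by
      have := Finset.sum_powerset_neg_one_pow_card (x := (Finset.univ : Finset V))
      rw [Finset.powerset_univ] at this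
      have h2 := congrArg (Int.cast : ℤ → 𝕜) this
      simpa [← Finset.card_eq_zero (s := (Finset.univ : Finset V))] using h2
    -- Isolate the term `T = V` in both sums; the remaining terms agree by induction.
    rw [← h', ← Finset.add_sum_erase _ _ (Finset.mem_univ Finset.univ),
      ← Finset.add_sum_erase _ _ (Finset.mem_univ Finset.univ), basis_induce_univ,
      Finset.card_univ, hn] at h
    refine add_right_cancel (h.trans (congrArg _ (Eq.symm ?_)))
    refine Finset.sum_congr rfl fun T hT => ?_
    have hlt : T.card < n := by
      rw [← hn]
      exact (Finset.card_lt_iff_ne_univ T).mpr (Finset.ne_of_mem_erase hT)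
    exact ih _ hlt (K.induce T) (Fintype.card_coe T)

end ComplexAlgebra

/-! ### Weak orientations and terminal sets -/

open Relation

/-- Both images are projections of the image of `x ↦ (f x, g x)`, and each projection is injective
there. This compares component counts of two different graphs, whose components live in different
types. -/
theorem Finset.card_image_eq_card_image {α β γ : Type*} [DecidableEq β] [DecidableEq γ]
    (s : Finset α) (f : α → β) (g : α → γ) (h : ∀ x ∈ s, ∀ y ∈ s, f x = f y ↔ g x = g y) :
    (s.image f).card = (s.image g).card := by
  have hf : ((s.image fun x => (f x, g x)).image Prod.fst).card =
      (s.image fun x => (f x, g x)).card := Finset.card_image_of_injOn <| by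
    simp only [Set.InjOn, Finset.coe_image, Set.forall_mem_image]
    exact fun x hx y hy hxy => Prod.ext hxy ((h x hx y hy).mp hxy)
  have hg : ((s.image fun x => (f x, g x)).image Prod.snd).card =
      (s.image fun x => (f x, g x)).card := Finset.card_image_of_injOn <| by
    simp only [Set.InjOn, Finset.coe_image, Set.forall_mem_image]
    exact fun x hx y hy hxy => Prod.ext ((h x hx y hy).mpr hxy) hxy
  rw [Finset.image_image] at hf hg
  exact hf.trans hg.symm

namespace SimpleGraph

variable {V : Type*} {G : SimpleGraph V} {U T : Finset V} {D : V → V → Prop}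

/-- A relation `D` is a *weak orientation* of `G` on `U` if it chooses at least one direction of
every edge of `G` inside `U`, has no other arcs, and every arc on a directed cycle is also
present in the opposite direction. -/
structure IsWeakOrientation (G : SimpleGraph V) (U : Finset V) (D : V → V → Prop) : Prop where
  adj : ∀ {v w}, D v w → G.Adj v w
  left_mem : ∀ {v w}, D v w → v ∈ U
  right_mem : ∀ {v w}, D v w → w ∈ U
  total : ∀ {v w}, v ∈ U → w ∈ U → G.Adj v w → D v w ∨ D w v
  swap : ∀ {v w}, ReflTransGen D v w → D w v → D v w

/-- The graph of the arcs that are present in both directions. -/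
def tieGraph (D : V → V → Prop) : SimpleGraph V where
  Adj v w := v ≠ w ∧ D v w ∧ D w v
  symm := ⟨fun _ _ h => ⟨h.1.symm, h.2.2, h.2.1⟩⟩
  loopless := ⟨fun _ h => h.1 rfl⟩

/-- A set `T` is *terminal* for `D` if no arc leaves it and all arcs starting in it are
present in both directions. -/
def IsTerminal (D : V → V → Prop) (T : Finset V) : Prop :=
  ∀ v ∈ T, ∀ w, D v w → w ∈ T ∧ D w v

theorem IsTerminal.mem_of_reflTransGen (hT : IsTerminal D T) {v w : V} (h : ReflTransGen D v w)
    (hv : v ∈ T) : w ∈ T := by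
  induction h with
  | refl => exact hv
  | tail _ h ih => exact (hT _ ih _ h).1

theorem reflTransGen_of_reachable_tieGraph {v w : V} (h : (tieGraph D).Reachable v w) :
    ReflTransGen D v w :=
  ReflTransGen.mono (fun _ _ h => h.2.1) _ _ ((reachable_iff_reflTransGen v w).mp h)

/-- A directed path starting in a terminal set stays in it, so all its arcs are ties. -/
theorem IsTerminal.reachable_of_reflTransGen (hT : IsTerminal D T) {v w : V} (hv : v ∈ T)
    (h : ReflTransGen D v w) : (tieGraph D).Reachable v w := by
  induction h with
  | refl => rfl
  | @tail b c hb h ih =>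
    -- `D` is an arbitrary relation here and may have loops, which the tie graph omits.
    rcases eq_or_ne b c with rfl | hne
    · exact ih
    · exact ih.trans (Adj.reachable ⟨hne, h, (hT _ (hT.mem_of_reflTransGen hb hv) _ h).2⟩)

/-- Restriction of a relation to a set. -/
def restrictRel (D : V → V → Prop) (S : Finset V) (v w : V) : Prop := v ∈ S ∧ w ∈ S ∧ D v w

variable [DecidableEq V]

/-- Extension of a relation by all arcs along edges of `G` from `U` to `T`. -/
def extendRel (G : SimpleGraph V) (D : V → V → Prop) (U T : Finset V) (v w : V) : Prop :=
  D v w ∨ (v ∈ U ∧ w ∈ T ∧ G.Adj v w)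

theorem IsWeakOrientation.restrictRel (hD : G.IsWeakOrientation U D) :
    G.IsWeakOrientation (U \ T) (restrictRel D (U \ T)) where
  adj h := hD.adj h.2.2
  left_mem h := h.1
  right_mem h := h.2.1
  total hv hw h := (hD.total (Finset.mem_sdiff.mp hv).1 (Finset.mem_sdiff.mp hw).1 h).imp
    (fun h => ⟨hv, hw, h⟩) (fun h => ⟨hw, hv, h⟩)
  swap h h' := ⟨h'.2.1, h'.1, hD.swap (ReflTransGen.mono (fun _ _ h => h.2.2) _ _ h) h'.2.2⟩

theorem IsWeakOrientation.isTerminal_extendRel (hD : G.IsWeakOrientation (U \ T) D)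
    (hTU : T ⊆ U) : IsTerminal (extendRel G D U T) T := by
  rintro v hv w (h | ⟨-, hw, h⟩)
  · exact absurd hv (Finset.mem_sdiff.mp (hD.left_mem h)).2
  · exact ⟨hw, Or.inr ⟨hTU hw, hv, h.symm⟩⟩

theorem IsWeakOrientation.extendRel (hD : G.IsWeakOrientation (U \ T) D) (hTU : T ⊆ U) :
    G.IsWeakOrientation U (extendRel G D U T) where
  adj h := h.elim hD.adj fun h => h.2.2
  left_mem h := h.elim (fun h => (Finset.mem_sdiff.mp (hD.left_mem h)).1) fun h => h.1
  right_mem h := h.elim (fun h => (Finset.mem_sdiff.mp (hD.right_mem h)).1) fun h => hTU h.2.1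
  total {v w} hv hw h := by
    by_cases hvT : v ∈ T
    · exact Or.inr (Or.inr ⟨hw, hvT, h.symm⟩)
    by_cases hwT : w ∈ T
    · exact Or.inl (Or.inr ⟨hv, hwT, h⟩)
    exact (hD.total (Finset.mem_sdiff.mpr ⟨hv, hvT⟩) (Finset.mem_sdiff.mpr ⟨hw, hwT⟩) h).imp
      Or.inl Or.inl
  swap {v w} h h' := by
    have hT := hD.isTerminal_extendRel hTU
    rcases h' with h' | ⟨hw, hv, h'⟩
    · have hwT := (Finset.mem_sdiff.mp (hD.left_mem h')).2
      refine Or.inl (hD.swap ?_ h')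
      clear h'
      -- An arc ending outside `T` is an arc of `D`, so it also starts outside `T`. Going backwards
      -- from `w`, the whole path lies in `D`.
      induction h with
      | refl => exact .refl
      | tail hb h ih =>
        rcases h with h | h
        · exact (ih (Finset.mem_sdiff.mp (hD.left_mem h)).2).tail h
        · exact absurd h.2.1 hwT
    · exact Or.inr ⟨hTU hv, hT.mem_of_reflTransGen h hv, h'.symm⟩

theorem IsWeakOrientation.extendRel_restrictRel (hD : G.IsWeakOrientation U D)
    (hT : IsTerminal D T) (hTU : T ⊆ U) :
    SimpleGraph.extendRel G (SimpleGraph.restrictRel D (U \ T)) U T = D := by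
  ext v w
  constructor
  · rintro (h | ⟨hv, hw, h⟩)
    · exact h.2.2
    -- If the edge only came with the arc `w → v`, terminality at `w ∈ T` would supply the reverse
    -- arc.
    · exact (hD.total hv (hTU hw) h).elim id fun h => (hT _ hw _ h).2
  · intro h
    by_cases hw : w ∈ T
    · exact Or.inr ⟨hD.left_mem h, hw, hD.adj h⟩
    · have hv : v ∉ T := fun hv => hw (hT _ hv _ h).1
      exact Or.inl ⟨Finset.mem_sdiff.mpr ⟨hD.left_mem h, hv⟩,
        Finset.mem_sdiff.mpr ⟨hD.right_mem h, hw⟩, h⟩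

theorem IsWeakOrientation.restrictRel_extendRel (hD : G.IsWeakOrientation (U \ T) D) :
    SimpleGraph.restrictRel (SimpleGraph.extendRel G D U T) (U \ T) = D := by
  ext v w
  constructor
  · rintro ⟨-, hw, h | h⟩
    · exact h
    · exact absurd h.2.1 (Finset.mem_sdiff.mp hw).2
  · exact fun h => ⟨hD.left_mem h, hD.right_mem h, Or.inl h⟩

open Classical in
/-- The number of connected components of the graph of ties that meet `S`. -/
noncomputable def numTieComponents (D : V → V → Prop) (S : Finset V) : ℕ :=
  (S.image (tieGraph D).connectedComponentMk).card

/-- A tie between `T` and its complement would be an arc leaving `T`. So tie paths starting outside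
`T` survive the restriction. -/
theorem IsWeakOrientation.numTieComponents_restrictRel (hD : G.IsWeakOrientation U D)
    (hT : IsTerminal D T) :
    numTieComponents (SimpleGraph.restrictRel D (U \ T)) (U \ T) =
      numTieComponents D (U \ T) := by
  classical
  refine Finset.card_image_eq_card_image _ _ _ fun x hx y hy => ?_
  rw [ConnectedComponent.eq, ConnectedComponent.eq]
  constructor
  · have hle : tieGraph (SimpleGraph.restrictRel D (U \ T)) ≤ tieGraph D :=
      fun _ _ h => ⟨h.1, h.2.1.2.2, h.2.2.2.2⟩
    exact fun h => h.mono hle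
  · intro h
    rw [reachable_iff_reflTransGen] at h
    clear hy
    suffices y ∈ U \ T ∧ (tieGraph (SimpleGraph.restrictRel D (U \ T))).Reachable x y from this.2
    induction h with
    | refl => exact ⟨hx, by rfl⟩
    | @tail b c _ h ih =>
      have hc : c ∈ U \ T := Finset.mem_sdiff.mpr ⟨hD.right_mem h.2.1, fun hc =>
        (Finset.mem_sdiff.mp ih.1).2 (hT _ hc _ h.2.2).1⟩
      exact ⟨hc, ih.2.trans (Adj.reachable ⟨h.1, ⟨ih.1, hc, h.2.1⟩, ⟨hc, ih.1, h.2.2⟩⟩)⟩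

omit [DecidableEq V] in
/-- A nonempty weak orientation has a terminal component. -/
theorem IsWeakOrientation.exists_terminal (hD : G.IsWeakOrientation U D) (hU : U.Nonempty) :
    ∃ v ∈ U, ∃ B ⊆ U, (∀ w, w ∈ B ↔ (tieGraph D).Reachable v w) ∧ IsTerminal D B := by
  classical
  have hmem : ∀ {v w}, v ∈ U → ReflTransGen D v w → w ∈ U := fun hv h => by
    induction h with
    | refl => exact hv
    | tail _ h _ => exact hD.right_mem h
  let R : V → Finset V := fun v => U.filter (ReflTransGen D v)
  -- A vertex with the fewest reachable vertices: by minimality, everything reachable from it leads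
  -- back to it.
  obtain ⟨v, hv, hmin⟩ := U.exists_min_image (fun v => (R v).card) hU
  have hback : ∀ w, ReflTransGen D v w → ReflTransGen D w v := fun w hw => by
    have hsub : R w ⊆ R v := fun x hx => by
      rw [Finset.mem_filter] at hx ⊢
      exact ⟨hx.1, hw.trans hx.2⟩
    have := Finset.eq_of_subset_of_card_le hsub (hmin w (hmem hv hw))
    have hvR : v ∈ R w := this ▸ Finset.mem_filter.mpr ⟨hv, .refl⟩
    exact (Finset.mem_filter.mp hvR).2
  have hB : IsTerminal D (R v) := fun x hx y h => by
    rw [Finset.mem_filter] at hx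
    exact ⟨Finset.mem_filter.mpr ⟨hD.right_mem h, hx.2.tail h⟩,
      hD.swap ((hback y (hx.2.tail h)).trans hx.2) h⟩
  refine ⟨v, hv, R v, Finset.filter_subset _ _, fun w => ⟨fun hw => ?_, fun hw => ?_⟩, hB⟩
  · exact hB.reachable_of_reflTransGen (Finset.mem_filter.mpr ⟨hv, .refl⟩)
      (Finset.mem_filter.mp hw).2
  · have := reflTransGen_of_reachable_tieGraph hw
    exact Finset.mem_filter.mpr ⟨hmem hv this, this⟩

open Classical in
-- Every terminal set contains a given terminal tie component `B` or is disjoint from it. Adding or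
-- removing `B` preserves terminality and changes the number of tie components outside by one,
-- giving a sign-reversing involution.
theorem IsWeakOrientation.sum_isTerminal (hD : G.IsWeakOrientation U D) (hU : U.Nonempty) :
    ∑ T ∈ U.powerset with IsTerminal D T, (-1 : ℤ) ^ numTieComponents D (U \ T) = 0 := by
  obtain ⟨v, hv, B, hBU, hB, hBt⟩ := hD.exists_terminal hU
  have hvB : v ∈ B := (hB v).mpr (by rfl)
  have hsub : ∀ T, IsTerminal D T → v ∈ T → B ⊆ T := fun T hT hvT x hx =>
    hT.mem_of_reflTransGen (reflTransGen_of_reachable_tieGraph ((hB x).mp hx)) hvT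
  have hdisj : ∀ T, IsTerminal D T → v ∉ T → Disjoint T B := fun T hT hvT =>
    Finset.disjoint_left.mpr fun x hx hxB => hvT
      (hT.mem_of_reflTransGen (reflTransGen_of_reachable_tieGraph ((hB x).mp hxB).symm) hx)
  have hcard : ∀ T ⊆ U, IsTerminal D T → v ∉ T →
      numTieComponents D (U \ T) = numTieComponents D (U \ (T ∪ B)) + 1 := by
    intro T hTU hT hvT
    have hd := hdisj T hT hvT
    have : U \ T = U \ (T ∪ B) ∪ B := by
      ext x
      have h1 : x ∈ B → x ∈ U := fun h => hBU h
      have h2 : x ∈ T → x ∉ B := fun h => Finset.disjoint_left.mp hd h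
      simp only [Finset.mem_sdiff, Finset.mem_union]
      tauto
    rw [numTieComponents, this, Finset.image_union]
    have himg : B.image (tieGraph D).connectedComponentMk =
        {(tieGraph D).connectedComponentMk v} := by
      ext c
      simp only [Finset.mem_image, Finset.mem_singleton]
      constructor
      · rintro ⟨x, hx, rfl⟩
        exact ConnectedComponent.sound ((hB x).mp hx).symm
      · rintro rfl
        exact ⟨v, hvB, rfl⟩
    rw [himg, Finset.union_comm, ← Finset.insert_eq, Finset.card_insert_of_notMem]
    · rfl
    · simp only [Finset.mem_image, not_exists, not_and]
      intro x hx h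
      exact (Finset.mem_sdiff.mp hx).2 (Finset.mem_union_right _
        ((hB x).mpr (ConnectedComponent.exact h).symm))
  have hunion : ∀ T, IsTerminal D T → IsTerminal D (T ∪ B) := fun T hT x hx y h => by
    rcases Finset.mem_union.mp hx with hx | hx
    · exact (hT x hx y h).imp_left (Finset.mem_union_left _)
    · exact (hBt x hx y h).imp_left (Finset.mem_union_right _)
  -- An arc from `T \ B` into `B` would be a tie, hence also an arc leaving `B`.
  have hsdiff : ∀ T, IsTerminal D T → IsTerminal D (T \ B) := fun T hT x hx y h => by
    rw [Finset.mem_sdiff] at hx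
    obtain ⟨h1, h2⟩ := hT x hx.1 y h
    exact ⟨Finset.mem_sdiff.mpr ⟨h1, fun hy => hx.2 (hBt y hy x h2).1⟩, h2⟩
  have hvs : ∀ T : Finset V, v ∉ T \ B := fun T h => (Finset.mem_sdiff.mp h).2 hvB
  refine Finset.sum_involution (fun T _ => if v ∈ T then T \ B else T ∪ B) ?_ ?_ ?_ ?_
  · intro T hT
    simp only [Finset.mem_filter, Finset.mem_powerset] at hT
    split_ifs with h
    · have := hcard _ (Finset.sdiff_subset.trans hT.1) (hsdiff T hT.2) (hvs T)
      rw [Finset.sdiff_union_of_subset (hsub T hT.2 h)] at this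
      rw [this, pow_succ]
      ring
    · rw [hcard T hT.1 hT.2 h, pow_succ]
      ring
  · intro T hT _ heq
    split_ifs at heq with h
    · exact hvs T (by rwa [heq])
    · exact h (heq ▸ Finset.mem_union_right _ hvB)
  · intro T hT
    simp only [Finset.mem_filter, Finset.mem_powerset] at hT ⊢
    split_ifs with h
    · exact ⟨Finset.sdiff_subset.trans hT.1, hsdiff T hT.2⟩
    · exact ⟨Finset.union_subset hT.1 hBU, hunion T hT.2⟩
  · intro T hT
    simp only [Finset.mem_filter, Finset.mem_powerset] at hT
    by_cases h : v ∈ T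
    · rw [if_pos h, if_neg (hvs T), Finset.sdiff_union_of_subset (hsub T hT.2 h)]
    · rw [if_neg h, if_pos (Finset.mem_union_right _ hvB),
        Finset.union_sdiff_cancel_right (hdisj T hT.2 h)]

/-! ### The signed count of weak orientations -/

variable [Fintype V]

open Classical in
/-- The signed number of weak orientations of `G` on `U`. -/
noncomputable def weakOrientationSum (G : SimpleGraph V) (U : Finset V) : ℤ :=
  ∑ D : V → V → Prop with G.IsWeakOrientation U D, (-1) ^ numTieComponents D U

/-- Each summand is rewritten over weak orientations on all of `U` with `T` terminal, so that the
sums over `T` and `D` can be exchanged and the inner one vanishes. -/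
theorem sum_weakOrientationSum_sdiff (G : SimpleGraph V) (hU : U.Nonempty) :
    ∑ T ∈ U.powerset, G.weakOrientationSum (U \ T) = 0 := by
  classical
  have key : ∀ T ∈ U.powerset, G.weakOrientationSum (U \ T) =
      ∑ D : V → V → Prop with G.IsWeakOrientation U D ∧ IsTerminal D T,
        (-1) ^ numTieComponents D (U \ T) := fun T hT => by
    rw [Finset.mem_powerset] at hT
    symm
    refine Finset.sum_bij' (fun D _ => SimpleGraph.restrictRel D (U \ T))
      (fun D _ => SimpleGraph.extendRel G D U T) ?_ ?_ ?_ ?_ ?_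
    all_goals intro D hD; simp only [Finset.mem_filter, Finset.mem_univ, true_and] at hD ⊢
    · exact hD.1.restrictRel
    · exact ⟨hD.extendRel hT, hD.isTerminal_extendRel hT⟩
    · exact hD.1.extendRel_restrictRel hD.2 hT
    · exact hD.restrictRel_extendRel
    · rw [hD.1.numTieComponents_restrictRel hD.2]
  rw [Finset.sum_congr rfl key]
  simp only [Finset.sum_filter, ite_and]
  rw [Finset.sum_comm]
  refine Finset.sum_eq_zero fun D _ => ?_
  by_cases hD : G.IsWeakOrientation U D
  · simp only [if_pos hD]
    rw [← Finset.sum_filter]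
    exact hD.sum_isTerminal hU
  · simp [hD]

theorem weakOrientationSum_empty (G : SimpleGraph V) : G.weakOrientationSum ∅ = 1 := by
  classical
  rw [weakOrientationSum, Finset.sum_eq_single (fun _ _ => False)]
  · simp [numTieComponents]
  · intro D hD hne
    rw [Finset.mem_filter] at hD
    refine absurd ?_ hne
    ext v w
    exact ⟨fun h => absurd (hD.2.left_mem h) (Finset.notMem_empty v), False.elim⟩
  · intro h
    refine absurd (Finset.mem_filter.mpr ⟨Finset.mem_univ _, ?_⟩) h
    constructor <;> simp

/-- The signs `(-1)^|U|` satisfy the same vanishing identity, and its `T = ∅` term is determined by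
the values on smaller sets. -/
theorem weakOrientationSum_eq (G : SimpleGraph V) (U : Finset V) :
    G.weakOrientationSum U = (-1) ^ U.card := by
  induction U using Finset.strongInduction with
  | H U ih =>
    rcases U.eq_empty_or_nonempty with rfl | hU
    · exact G.weakOrientationSum_empty
    have h := G.sum_weakOrientationSum_sdiff hU
    have h' := Finset.sum_powerset_neg_one_pow_card_of_nonempty hU
    have h2 : ∑ T ∈ U.powerset, (-1 : ℤ) ^ (U \ T).card = 0 := by
      rw [← h']
      refine Finset.sum_bij' (fun T _ => U \ T) (fun T _ => U \ T) ?_ ?_ ?_ ?_ ?_ <;>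
        simp +contextual
    rw [← Finset.add_sum_erase _ _ (Finset.empty_mem_powerset U), Finset.sdiff_empty] at h h2
    rw [eq_neg_of_add_eq_zero_left h, eq_neg_of_add_eq_zero_left h2]
    refine congrArg _ (Finset.sum_congr rfl fun T hT => ih _ ?_)
    rw [Finset.mem_erase, Finset.mem_powerset] at hT
    exact Finset.sdiff_ssubset hT.2 (Finset.nonempty_iff_ne_empty.mpr hT.1)

end SimpleGraph

/-! ### Weak orientations as flats with acyclic orientations of the contraction -/

namespace SimpleGraph

variable {V : Type*} {G : SimpleGraph V} {F : Set (Sym2 V)} {D : V → V → Prop}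

theorem isFlat_iff : G.IsFlat F ↔ F ⊆ G.edgeSet ∧
    ∀ v w, (fromEdgeSet F).Reachable v w → G.Adj v w → s(v, w) ∈ F := by
  refine and_congr_right fun hF => ⟨fun h v w hr hvw => ?_, fun h c => ?_⟩
  · have := congrArg (fun H => H.Adj ⟨v, rfl⟩ ⟨w, ConnectedComponent.sound hr.symm⟩)
      (h ((fromEdgeSet F).connectedComponentMk v))
    simp only [comap_adj, Function.Embedding.subtype_apply, fromEdgeSet_adj] at this
    exact (this.mpr hvw).1
  · ext ⟨v, hv⟩ ⟨w, hw⟩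
    simp only [comap_adj, Function.Embedding.subtype_apply, fromEdgeSet_adj]
    exact ⟨fun h => hF h.1, fun hvw =>
      ⟨h v w (ConnectedComponent.exact (hv.trans hw.symm)) hvw, hvw.ne⟩⟩

/-- An edge of `G` whose ends are joined by ties closes a directed cycle with them, so it is itself
a tie. -/
theorem edgeSet_tieGraph_isFlat [Fintype V] (hD : G.IsWeakOrientation Finset.univ D) :
    G.IsFlat (tieGraph D).edgeSet := by
  refine isFlat_iff.mpr ⟨edgeSet_mono fun v w h => hD.adj h.2.1, fun v w hr hvw => ?_⟩
  rw [fromEdgeSet_edgeSet] at hr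
  have h1 := reflTransGen_of_reachable_tieGraph hr
  have h2 := reflTransGen_of_reachable_tieGraph hr.symm
  rcases hD.total (Finset.mem_univ v) (Finset.mem_univ w) hvw with h | h
  · exact ⟨hvw.ne, h, hD.swap h2 h⟩
  · exact ⟨hvw.ne, hD.swap h1 h, h⟩

/-- The relation on vertices given by a set of edges, taken in both directions, and the arcs of an
orientation of the contraction by these edges. -/
def liftRel (G : SimpleGraph V) (F : Set (Sym2 V))
    (O : Digraph (fromEdgeSet F).ConnectedComponent) (v w : V) : Prop :=
  s(v, w) ∈ F ∨ G.Adj v w ∧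
    O.Adj ((fromEdgeSet F).connectedComponentMk v) ((fromEdgeSet F).connectedComponentMk w)

/-- The digraph that a relation on the vertices induces on the contraction by a set of edges. -/
def quotientRel (F : Set (Sym2 V)) (D : V → V → Prop) :
    Digraph (fromEdgeSet F).ConnectedComponent where
  Adj c d := c ≠ d ∧ ∃ v w, v ∈ c.supp ∧ w ∈ d.supp ∧ D v w

theorem mk_eq_of_mem (hF : F ⊆ G.edgeSet) {v w : V} (h : s(v, w) ∈ F) :
    (fromEdgeSet F).connectedComponentMk v = (fromEdgeSet F).connectedComponentMk w :=
  ConnectedComponent.sound (Adj.reachable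
    ((fromEdgeSet_adj F).mpr ⟨h, (show G.Adj v w from hF h).ne⟩))

section lift

variable {O : Digraph (fromEdgeSet F).ConnectedComponent}

theorem reflTransGen_of_liftRel (hF : F ⊆ G.edgeSet) {v w : V}
    (h : ReflTransGen (liftRel G F O) v w) : ReflTransGen O.Adj
      ((fromEdgeSet F).connectedComponentMk v) ((fromEdgeSet F).connectedComponentMk w) := by
  induction h with
  | refl => exact .refl
  | tail _ h ih =>
    rcases h with h | h
    · rwa [← mk_eq_of_mem hF h]
    · exact ih.tail h.2

theorem isWeakOrientation_liftRel [Fintype V] (hF : G.IsFlat F)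
    (hO : (G.contract F).IsOrientation O) (hc : ∀ c, ¬ TransGen O.Adj c c) :
    G.IsWeakOrientation Finset.univ (liftRel G F O) where
  adj h := h.elim (fun h => hF.1 h) And.left
  left_mem _ := Finset.mem_univ _
  right_mem _ := Finset.mem_univ _
  total {v w} _ _ h := by
    by_cases hvw : (fromEdgeSet F).connectedComponentMk v = (fromEdgeSet F).connectedComponentMk w
    · exact Or.inl (Or.inl ((isFlat_iff.mp hF).2 v w (ConnectedComponent.exact hvw) h))
    · exact ((hO.1 _ _).mp ⟨hvw, v, w, rfl, rfl, h⟩).imp (fun h' => Or.inr ⟨h, h'⟩)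
        (fun h' => Or.inr ⟨h.symm, h'⟩)
  swap {v w} h h' := by
    rcases h' with h' | h'
    · exact Or.inl (Sym2.eq_swap ▸ h')
    -- An arc from `O` on a directed cycle upstairs would project to a directed cycle of `O`.
    · exact absurd (TransGen.head' h'.2 (reflTransGen_of_liftRel hF.1 h)) (hc _)

theorem edgeSet_tieGraph_liftRel (hF : F ⊆ G.edgeSet) (hO : (G.contract F).IsOrientation O) :
    (tieGraph (liftRel G F O)).edgeSet = F := by
  ext e
  induction e with
  | h v w =>
    rw [mem_edgeSet]
    constructor
    · rintro ⟨-, h | h, h' | h'⟩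
      · exact h
      · exact h
      · exact Sym2.eq_swap ▸ h'
      · exact absurd h'.2 (hO.2 _ _ h.2)
    · exact fun h => ⟨(show G.Adj v w from hF h).ne, Or.inl h, Or.inl (Sym2.eq_swap ▸ h)⟩

theorem quotientRel_liftRel (hF : F ⊆ G.edgeSet) (hO : (G.contract F).IsOrientation O) :
    quotientRel F (liftRel G F O) = O := by
  ext c d
  constructor
  · rintro ⟨hcd, v, w, rfl, rfl, h | h⟩
    · exact absurd (mk_eq_of_mem hF h) hcd
    · exact h.2
  · intro h
    obtain ⟨hcd, v, w, rfl, rfl, hvw⟩ := (hO.1 c d).mpr (Or.inl h)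
    exact ⟨hcd, v, w, rfl, rfl, Or.inr ⟨hvw, h⟩⟩

end lift

section quotient

theorem reflTransGen_of_mk_eq (hDF : (tieGraph D).edgeSet = F) {v w : V}
    (h : (fromEdgeSet F).connectedComponentMk v = (fromEdgeSet F).connectedComponentMk w) :
    ReflTransGen D v w := by
  have h := ConnectedComponent.exact h
  rw [← hDF, fromEdgeSet_edgeSet] at h
  exact reflTransGen_of_reachable_tieGraph h

/-- Each arc of the contraction comes from an arc of `D`; consecutive ones are linked by ties inside
a component. -/
theorem reflTransGen_of_quotientRel (hDF : (tieGraph D).edgeSet = F) {v w : V}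
    (h : ReflTransGen (quotientRel F D).Adj
      ((fromEdgeSet F).connectedComponentMk v) ((fromEdgeSet F).connectedComponentMk w)) :
    ReflTransGen D v w := by
  -- Only the class of the endpoint is fixed, so its representative may vary in the induction.
  generalize hd : (fromEdgeSet F).connectedComponentMk w = d at h
  induction h generalizing w with
  | refl => exact reflTransGen_of_mk_eq hDF hd.symm
  | tail _ h ih =>
    obtain ⟨-, x, y, hx, hy, hxy⟩ := h
    exact ((ih hx).tail hxy).trans (reflTransGen_of_mk_eq hDF (hy.trans hd.symm))

/-- A directed cycle lifts to one of `D`, whose first arc is then a tie and so cannot join different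
components. -/
theorem not_transGen_quotientRel [Fintype V] (hD : G.IsWeakOrientation Finset.univ D)
    (hDF : (tieGraph D).edgeSet = F) (c : (fromEdgeSet F).ConnectedComponent) :
    ¬ TransGen (quotientRel F D).Adj c c := by
  intro h
  obtain ⟨d, ⟨hcd, v, w, rfl, rfl, hvw⟩, h⟩ := TransGen.head'_iff.mp h
  have hwv := hD.swap (reflTransGen_of_quotientRel hDF h) hvw
  have hF : F ⊆ G.edgeSet := hDF ▸ (edgeSet_tieGraph_isFlat hD).1
  refine hcd (mk_eq_of_mem hF ?_)
  rw [← hDF]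
  exact ⟨(hD.adj hvw).ne, hvw, hwv⟩

theorem isOrientation_quotientRel [Fintype V] (hD : G.IsWeakOrientation Finset.univ D)
    (hDF : (tieGraph D).edgeSet = F) : (G.contract F).IsOrientation (quotientRel F D) := by
  refine ⟨fun c d => ⟨?_, ?_⟩, fun c d h h' =>
    not_transGen_quotientRel hD hDF c (.tail (.single h) h')⟩
  · rintro ⟨hcd, v, w, hv, hw, h⟩
    exact (hD.total (Finset.mem_univ v) (Finset.mem_univ w) h).imp
      (fun h => ⟨hcd, v, w, hv, hw, h⟩) (fun h => ⟨hcd.symm, w, v, hw, hv, h⟩)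
  · rintro (⟨hcd, v, w, hv, hw, h⟩ | ⟨hcd, v, w, hv, hw, h⟩)
    · exact ⟨hcd, v, w, hv, hw, hD.adj h⟩
    · exact ⟨hcd.symm, w, v, hw, hv, (hD.adj h).symm⟩

theorem liftRel_quotientRel [Fintype V] (hD : G.IsWeakOrientation Finset.univ D)
    (hDF : (tieGraph D).edgeSet = F) : liftRel G F (quotientRel F D) = D := by
  have hF : F ⊆ G.edgeSet := hDF ▸ (edgeSet_tieGraph_isFlat hD).1
  ext v w
  constructor
  · rintro (h | ⟨hvw, h⟩)
    · rw [← hDF] at h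
      exact h.2.1
    · rcases hD.total (Finset.mem_univ v) (Finset.mem_univ w) hvw with h' | h'
      · exact h'
      -- With only `w → v` in `D`, the contraction would have arcs both ways between the two
      -- components, a directed cycle.
      · exact absurd (TransGen.tail (.single h) ⟨h.1.symm, w, v, rfl, rfl, h'⟩)
          (not_transGen_quotientRel hD hDF _)
  · intro h
    by_cases hvw : (fromEdgeSet F).connectedComponentMk v = (fromEdgeSet F).connectedComponentMk w
    · refine Or.inl ?_
      rw [← hDF]
      exact ⟨(hD.adj h).ne, h, hD.swap (reflTransGen_of_mk_eq hDF hvw.symm) h⟩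
    · exact Or.inr ⟨hD.adj h, hvw, v, w, rfl, rfl, h⟩

end quotient

variable [Fintype V]

/-- Lifting an orientation and passing to the quotient are mutually inverse, which turns `a(G/F)`
into the size of the fibre over `F` of the map sending a weak orientation to its ties. -/
theorem numAcyclicOrientations_contract (hF : G.IsFlat F) :
    (G.contract F).numAcyclicOrientations =
      Nat.card {D // G.IsWeakOrientation Finset.univ D ∧ (tieGraph D).edgeSet = F} :=
  Nat.card_congr
    { toFun := fun O => ⟨liftRel G F O.1, isWeakOrientation_liftRel hF O.2.1 O.2.2,
        edgeSet_tieGraph_liftRel hF.1 O.2.1⟩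
      invFun := fun D => ⟨quotientRel F D.1, isOrientation_quotientRel D.2.1 D.2.2,
        not_transGen_quotientRel D.2.1 D.2.2⟩
      left_inv := fun O => Subtype.ext (quotientRel_liftRel hF.1 O.2.1)
      right_inv := fun D => Subtype.ext (liftRel_quotientRel D.2.1 D.2.2) }

theorem numComponents_edgeSet_tieGraph (D : V → V → Prop) :
    numComponents (tieGraph D).edgeSet = numTieComponents D Finset.univ := by
  classical
  rw [numComponents, fromEdgeSet_edgeSet, numTieComponents,
    Finset.image_univ_of_surjective (f := (tieGraph D).connectedComponentMk) Quot.mk_surjective,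
    Finset.card_univ,
    Nat.card_eq_fintype_card]

/-- The sum over all flats `F` of a graph with `n` vertices of `(-1) ^ c(F) * a(G / F)` is
`(-1) ^ n`. -/
theorem sum_flats (G : SimpleGraph V) :
    ∑ F ∈ G.flats, (-1 : ℤ) ^ numComponents F * ((G.contract F).numAcyclicOrientations : ℤ) =
      (-1) ^ Fintype.card V := by
  classical
  -- Write `(-1)^n` as the signed count on all of `V` and group the weak orientations by their flat
  -- of ties; the sign is constant on each group.
  rw [← Finset.card_univ, ← weakOrientationSum_eq G, weakOrientationSum,
    ← Finset.sum_fiberwise_of_maps_to (t := G.flats) (g := fun D => (tieGraph D).edgeSet)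
      fun D hD => by simpa [flats] using edgeSet_tieGraph_isFlat (Finset.mem_filter.mp hD).2]
  refine Finset.sum_congr rfl fun F hF => ?_
  have hF : G.IsFlat F := by simpa [flats] using hF
  have hterm : ∀ D ∈ ({D | G.IsWeakOrientation Finset.univ D} : Finset (V → V → Prop)).filter
      (fun D => (tieGraph D).edgeSet = F),
      (-1 : ℤ) ^ numTieComponents D Finset.univ = (-1) ^ numComponents F := fun D hD => by
    rw [← (Finset.mem_filter.mp hD).2, numComponents_edgeSet_tieGraph]
  rw [Finset.sum_congr rfl hterm, Finset.sum_const, nsmul_eq_mul, mul_comm,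
    numAcyclicOrientations_contract hF, Finset.filter_filter, Nat.card_eq_fintype_card,
    Fintype.card_subtype]

end SimpleGraph

theorem mainTheorem4 {V : Type*} [Fintype V] (Γ : AbstractSimplicialComplex V) (n : ℕ)
    (hn : Fintype.card V = n) :
    (-1 : ℤ) ^ n = ∑ F ∈ Γ.oneSkeleton.flats,
        (-1 : ℤ) ^ SimpleGraph.numComponents F *
          ((Γ.oneSkeleton.contract F).numAcyclicOrientations : ℤ) ∧
    ∀ (𝕜 : Type*) [Field 𝕜],
      ComplexAlgebra.coeffSum 𝕜
        (HopfAlgebra.antipode 𝕜 (ComplexAlgebra.basis 𝕜 Γ)) = (-1 : 𝕜) ^ n := by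
  subst hn
  exact ⟨(SimpleGraph.sum_flats _).symm,
    fun 𝕜 _ => ComplexAlgebra.coeffSum_antipode_basis 𝕜 _ Γ rfl⟩
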